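/- Let $\Omega \subset \mathbb{R}^2$ be a bounded open set with smooth ($C^\infty$) boundary, i.e. for every $p \in \partial\Omega$ there are $r>0$, Cartesian coordinates $(x_1,x_2)$ obtained from the standard ones by a linear isometry of $\mathbb{R}^2$, and a $C^\infty$ function $\gamma:\mathbb{R}\to\mathbb{R}$ such that $\Omega \cap B(p,r) = \{x \in B(p,r) : x_2 > \gamma(x_1)\}$. (Connectedness of $\Omega$ is not assumed.) Let $|\Omega|$ denote the area (Lebesgue measure) of $\Omega$ and $|\partial\Omega|$ the length (one-dimensional Hausdorff measure) of its boundary. Then $|\partial\Omega|$ is finite and $$|\partial\Omega|^2 \;\ge\; 4\pi\,|\Omega| .$$ -/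

import Mathlib

open MeasureTheory
open scoped ContDiff

/-- A set `Ω` in the Euclidean plane has smooth boundary if near every boundary point, after a
rotation or reflection of the coordinate axes, `Ω` is the region lying strictly above the graph
of a smooth (`C^∞`) function of one variable. -/
def HasSmoothBoundary (Ω : Set (EuclideanSpace ℝ (Fin 2))) : Prop :=
  ∀ p ∈ frontier Ω, ∃ r > 0,
    ∃ e : EuclideanSpace ℝ (Fin 2) ≃ₗᵢ[ℝ] EuclideanSpace ℝ (Fin 2),
      ∃ γ : ℝ → ℝ, ContDiff ℝ ∞ γ ∧
        ∀ x ∈ Metric.ball p r, x ∈ Ω ↔ γ (e x 0) < e x 1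

/-! Write P for the length of the boundary. The proof applies the flux bound ∫_Ω div F ≤ P · sup ‖F‖
twice. For fixed x and v, reflecting v in the line orthogonal to x - y gives a field in y of norm
‖v‖, and in the plane its divergence is ⟪2(x - y)/‖x - y‖², v⟫. Hence G(x) = ∫_Ω 2(x - y)/‖x - y‖²
dy satisfies ⟪G(x), v⟫ ≤ P‖v‖ for every v, that is ‖G‖ ≤ P. Since 2z/‖z‖² is the gradient of 2 log
‖z‖, its divergence is 4π times the Dirac mass, so div G = 4π on Ω. The flux bound for G itself then
gives 4π|Ω| ≤ P².

The singularity is removed by replacing ‖z‖² with ‖z‖² + ε in denominators: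
`norm_chordReflection_le`, `divergence_chordReflection` and `divergence_chordField` give
`HasSmoothBoundary.integral_chordKernel_le`, and `tendsto_integral_chordKernel` with
`integral_chordKernel_one` lets ε tend to 0.

The flux bound comes from a partition of unity and the divergence theorem above a graph. Only an
inequality is needed, so half of the area formula for curves suffices:
`lintegral_comp_mul_enorm_deriv_le`. -/

/-! ### Arc length is at most Hausdorff measure. -/

/-- The one-dimensional Hausdorff measure of an arc is at least the distance of its endpoints. -/
theorem edist_le_hausdorffMeasure_image_Icc {X : Type*} [MetricSpace X] [MeasurableSpace X]
    [BorelSpace X] {c : ℝ → X} (hc : Continuous c) {a b : ℝ} (hab : a ≤ b) :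
    edist (c a) (c b) ≤ μH[1] (c '' Set.Icc a b) := by
  have hlip : LipschitzWith 1 (fun z : X => dist z (c a)) := LipschitzWith.dist_left (c a)
  have h1 := hlip.hausdorffMeasure_image_le (d := 1) zero_le_one (c '' Set.Icc a b)
  rw [ENNReal.coe_one, ENNReal.one_rpow, one_mul, hausdorffMeasure_real] at h1
  refine le_trans ?_ h1
  -- The distance to `c a` is 1-Lipschitz, and by the intermediate value theorem its values on the
  -- arc fill this interval.
  have hsub : Set.Icc 0 (dist (c b) (c a)) ⊆
      (fun z : X => dist z (c a)) '' (c '' Set.Icc a b) := by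
    rw [Set.image_image]
    have := intermediate_value_Icc (f := fun t => dist (c t) (c a)) hab
      (hc.dist continuous_const).continuousOn
    simpa using this
  refine le_trans (le_of_eq ?_) (measure_mono hsub)
  rw [Real.volume_Icc, sub_zero, edist_comm, edist_dist]

/-- A `C¹` curve is locally Lipschitz, so short arcs have finite length. Besicovitch differentiation
of the pullback needs this. -/
theorem isLocallyFiniteMeasure_comap_hausdorffMeasure {E : Type*} [NormedAddCommGroup E]
    [NormedSpace ℝ E] [MeasurableSpace E] [BorelSpace E] {c : ℝ → E} (hc : ContDiff ℝ 1 c)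
    (hinj : Function.Injective c) :
    IsLocallyFiniteMeasure (μH[1].comap c : Measure ℝ) := by
  have hemb : MeasurableEmbedding c := hc.continuous.measurableEmbedding hinj
  refine ⟨fun x => ?_⟩
  obtain ⟨K, t, ht, hK⟩ := hc.contDiffAt.exists_lipschitzOnWith (x := x)
  obtain ⟨r, hr, hrt⟩ := Metric.nhds_basis_closedBall.mem_iff.1 ht
  refine ⟨Metric.closedBall x r, Metric.closedBall_mem_nhds x hr, ?_⟩
  rw [hemb.comap_apply]
  refine lt_of_le_of_lt ((hK.mono hrt).hausdorffMeasure_image_le zero_le_one) ?_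
  rw [hausdorffMeasure_real]
  exact ENNReal.mul_lt_top (by simp) (isCompact_closedBall x r).measure_lt_top

/-- For an injective `C¹` curve, the pullback of the one-dimensional Hausdorff measure has density
at least the speed of the curve. -/
theorem enorm_deriv_le_rnDeriv_comap_hausdorffMeasure {E : Type*} [NormedAddCommGroup E]
    [NormedSpace ℝ E] [MeasurableSpace E] [BorelSpace E] {c : ℝ → E} (hc : ContDiff ℝ 1 c)
    (hinj : Function.Injective c) :
    ∀ᵐ t : ℝ, ‖deriv c t‖ₑ ≤ (μH[1].comap c : Measure ℝ).rnDeriv volume t := by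
  have hemb : MeasurableEmbedding c := hc.continuous.measurableEmbedding hinj
  have := isLocallyFiniteMeasure_comap_hausdorffMeasure hc hinj
  filter_upwards [Besicovitch.ae_tendsto_rnDeriv (μH[1].comap c : Measure ℝ) volume] with t ht
  have hd : HasDerivAt c (deriv c t) t :=
    ((hc.differentiable one_ne_zero) t).hasDerivAt
  -- The symmetric quotient matches the balls centred at `t` in Besicovitch's theorem: chord over
  -- interval length is at most arc measure over interval length.
  have h1 : Filter.Tendsto (fun r : ℝ => (2 * r)⁻¹ • (c (t + r) - c (t - r)))
      (nhdsWithin 0 (Set.Ioi 0)) (nhds (deriv c t)) := by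
    have hp : HasDerivAt (fun r : ℝ => c (t + r) - c (t - r)) (deriv c t + deriv c t) 0 := by
      have e1 : HasDerivAt (fun r : ℝ => c (t + r)) (deriv c t) 0 :=
        HasDerivAt.comp_const_add t 0 (by simpa only [add_zero] using hd)
      have e2 : HasDerivAt (fun r : ℝ => c (t - r)) (-deriv c t) 0 :=
        HasDerivAt.comp_const_sub t 0 (by simpa only [sub_zero] using hd)
      simpa only [sub_neg_eq_add] using e1.fun_sub e2
    have h2 := (hp.tendsto_slope_zero_right).const_smul (2⁻¹ : ℝ)
    refine (h2.congr fun r => ?_).trans (le_of_eq ?_)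
    · simp [smul_smul, mul_comm]
    · congr 1
      rw [← two_smul ℝ, smul_smul]; norm_num
  refine le_of_tendsto_of_tendsto (Filter.Tendsto.enorm h1) ht ?_
  filter_upwards [self_mem_nhdsWithin] with r (hr : 0 < r)
  rw [hemb.comap_apply, Real.closedBall_eq_Icc, Real.volume_Icc,
    show t + r - (t - r) = 2 * r by ring, enorm_smul, div_eq_mul_inv, mul_comm]
  gcongr
  · rw [← edist_eq_enorm_sub, edist_comm]
    exact edist_le_hausdorffMeasure_image_Icc hc.continuous (by linarith)
  · rw [Real.enorm_eq_ofReal (by positivity), ENNReal.ofReal_inv_of_pos (by positivity)]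

/-- The integral of a function along an injective `C¹` curve is at most its integral over the range
of the curve with respect to the one-dimensional Hausdorff measure. -/
theorem lintegral_comp_mul_enorm_deriv_le {E : Type*} [NormedAddCommGroup E]
    [NormedSpace ℝ E] [MeasurableSpace E] [BorelSpace E] {c : ℝ → E} (hc : ContDiff ℝ 1 c)
    (hinj : Function.Injective c) {f : E → ENNReal} (hf : Measurable f) :
    ∫⁻ t, ‖deriv c t‖ₑ * f (c t) ≤ ∫⁻ z in Set.range c, f z ∂μH[1] := by
  have hemb : MeasurableEmbedding c := hc.continuous.measurableEmbedding hinj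
  set ν : Measure ℝ := μH[1].comap c
  calc ∫⁻ t, ‖deriv c t‖ₑ * f (c t)
      ≤ ∫⁻ t, ν.rnDeriv volume t * f (c t) := by
        refine lintegral_mono_ae ?_
        filter_upwards [enorm_deriv_le_rnDeriv_comap_hausdorffMeasure hc hinj] with t ht
        gcongr
    _ = ∫⁻ t, f (c t) ∂(volume.withDensity (ν.rnDeriv volume)) :=
        (lintegral_withDensity_eq_lintegral_mul _ (Measure.measurable_rnDeriv _ _)
          (hf.comp hemb.measurable)).symm
    -- A possible singular part of `ν` is simply dropped.
    _ ≤ ∫⁻ t, f (c t) ∂ν := lintegral_mono' (Measure.withDensity_rnDeriv_le _ _) le_rfl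
    _ = ∫⁻ z in Set.range c, f z ∂μH[1] := by
        rw [← hemb.map_comap, hemb.lintegral_map]

/-! ### Divergence of vector fields. -/

section Divergence

variable {E : Type*} [NormedAddCommGroup E] [InnerProductSpace ℝ E]

/-- The divergence of a vector field. -/
noncomputable def divergence (F : E → E) (x : E) : ℝ :=
  LinearMap.trace ℝ E (fderiv ℝ F x : E →ₗ[ℝ] E)

theorem divergence_eq_sum_inner {ι : Type*} [Fintype ι] (b : OrthonormalBasis ι ℝ E) (F : E → E)
    (x : E) : divergence F x = ∑ i, inner ℝ (b i) (fderiv ℝ F x (b i)) :=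
  LinearMap.trace_eq_sum_inner _ b

theorem divergence_eq_zero_of_notMem_tsupport {F : E → E} {x : E} (hx : x ∉ tsupport F) :
    divergence F x = 0 := by
  have : fderiv ℝ F x = 0 := by
    by_contra h
    exact hx (support_fderiv_subset ℝ h)
  simp [divergence, this]

theorem continuous_divergence [FiniteDimensional ℝ E] {F : E → E} (hF : ContDiff ℝ 1 F) :
    Continuous (divergence F) := by
  have h := hF.continuous_fderiv one_ne_zero
  simp_rw [funext fun x => divergence_eq_sum_inner (stdOrthonormalBasis ℝ E) F x]
  fun_prop

theorem divergence_sum {ι : Type*} (s : Finset ι) {F : ι → E → E} {x : E}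
    (hF : ∀ i ∈ s, DifferentiableAt ℝ (F i) x) :
    divergence (fun y => ∑ i ∈ s, F i y) x = ∑ i ∈ s, divergence (F i) x := by
  simp only [divergence]
  rw [fderiv_fun_sum hF, ContinuousLinearMap.toLinearMap_sum, map_sum]

variable [MeasurableSpace E] [BorelSpace E] [FiniteDimensional ℝ E]

theorem integrable_divergence {F : E → E} (hF : ContDiff ℝ 1 F) (hc : HasCompactSupport F) :
    Integrable (divergence F) := by
  refine (continuous_divergence hF).integrable_of_hasCompactSupport
    (hc.mono' fun x hx => ?_)
  by_contra h
  exact hx (divergence_eq_zero_of_notMem_tsupport h)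

/-- Integrating by parts against the constant function 1 kills every directional derivative. -/
theorem integral_divergence_eq_zero {F : E → E} (hF : ContDiff ℝ 1 F) (hc : HasCompactSupport F) :
    ∫ x, divergence F x = 0 := by
  set b := stdOrthonormalBasis ℝ E
  have hd := hF.continuous_fderiv one_ne_zero
  have hcd : HasCompactSupport (fderiv ℝ F) := hc.fderiv ℝ
  have hint (v : E) : Integrable (fun x => fderiv ℝ F x v) :=
    (by fun_prop : Continuous fun x => fderiv ℝ F x v).integrable_of_hasCompactSupport
      (hcd.comp_left (g := fun L : E →L[ℝ] E => L v) (by simp))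
  have h0 (v : E) : ∫ x, fderiv ℝ F x v = 0 := by
    have := integral_smul_fderiv_eq_neg_fderiv_smul_of_integrable (μ := (volume : Measure E))
      (𝕜 := ℝ) (f := fun _ : E => (1 : ℝ)) (g := F) (v := v) (by simp)
      (by simpa using hint v)
      (by simpa using hF.continuous.integrable_of_hasCompactSupport hc)
      (fun x _ => differentiableAt_const _) (fun x _ => hF.differentiable one_ne_zero x)
    simpa using this
  simp_rw [divergence_eq_sum_inner b]
  rw [integral_finsetSum _ fun i _ => (hint (b i)).const_inner (b i)]
  refine Finset.sum_eq_zero fun i _ => ?_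
  rw [integral_inner (hint (b i)), h0, inner_zero_right]

end Divergence

/-! ### The divergence theorem and the flux bound at a graph. -/

section Graph

variable {E : Type*} [NormedAddCommGroup E] [InnerProductSpace ℝ E]

theorem OrthonormalBasis.eq_fin_two (b : OrthonormalBasis (Fin 2) ℝ E) (z : E) :
    inner ℝ (b 0) z • b 0 + inner ℝ (b 1) z • b 1 = z := by
  simpa [Fin.sum_univ_two] using b.sum_repr' z

/-- The coordinates `(x, s) ↦ (x, γ x + s)` with respect to an orthonormal basis of a plane, which
straighten the graph of `γ`. -/
noncomputable def graphHomeomorph (b : OrthonormalBasis (Fin 2) ℝ E) {γ : ℝ → ℝ}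
    (hγ : Continuous γ) : ℝ × ℝ ≃ₜ E where
  toFun p := p.1 • b 0 + (γ p.1 + p.2) • b 1
  invFun z := (inner ℝ (b 0) z, inner ℝ (b 1) z - γ (inner ℝ (b 0) z))
  left_inv p := by
    have h01 : inner ℝ (b 0) (b 1) = 0 := b.orthonormal.2 (by decide)
    have h10 : inner ℝ (b 1) (b 0) = 0 := b.orthonormal.2 (by decide)
    ext <;> simp [inner_add_right, inner_smul_right, h01, h10]
  right_inv z := by simpa using b.eq_fin_two z
  continuous_toFun := by fun_prop
  continuous_invFun := by fun_prop

theorem graphHomeomorph_apply (b : OrthonormalBasis (Fin 2) ℝ E) {γ : ℝ → ℝ}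
    (hγ : Continuous γ) (p : ℝ × ℝ) :
    graphHomeomorph b hγ p = p.1 • b 0 + (γ p.1 + p.2) • b 1 := rfl

/-- The two vectors differ by a quarter turn: the unnormalized normal is as long as the tangent, so
the flux density is at most speed times ‖F‖. -/
theorem norm_graph_tangent (b : OrthonormalBasis (Fin 2) ℝ E) (a : ℝ) :
    ‖b 0 + a • b 1‖ = ‖a • b 0 - b 1‖ := by
  have h01 : inner ℝ (b 0) (b 1) = 0 := b.orthonormal.2 (by decide)
  rw [← sq_eq_sq₀ (norm_nonneg _) (norm_nonneg _), norm_add_sq_real, norm_sub_sq_real]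
  simp [inner_smul_right, inner_smul_left, h01, norm_smul]
  ring

variable [MeasurableSpace E] [BorelSpace E]

/-- If a set lies above a graph near some point, its boundary has locally finite length there. -/
theorem hausdorffMeasure_frontier_inter_ball_lt_top (b : OrthonormalBasis (Fin 2) ℝ E) {γ : ℝ → ℝ}
    (hγ : ContDiff ℝ 1 γ) {Ω : Set E} (hΩ : IsOpen Ω) {p : E} {r : ℝ}
    (hgraph : ∀ z ∈ Metric.ball p r, z ∈ Ω ↔ γ (inner ℝ (b 0) z) < inner ℝ (b 1) z) :
    μH[1] (frontier Ω ∩ Metric.ball p r) < ⊤ := by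
  have hγc := hγ.continuous
  set c : ℝ → E := fun t => t • b 0 + γ t • b 1 with hc_def
  have hcd : ContDiff ℝ 1 c := by fun_prop
  set I : Set ℝ := Set.Icc (inner ℝ (b 0) p - r) (inner ℝ (b 0) p + r)
  have hsub : frontier Ω ∩ Metric.ball p r ⊆ c '' I := by
    rintro z ⟨hzf, hzb⟩
    rw [hΩ.frontier_eq] at hzf
    have hle : inner ℝ (b 1) z ≤ γ (inner ℝ (b 0) z) := not_lt.1 fun h => hzf.2 ((hgraph z hzb).2 h)
    have hge : γ (inner ℝ (b 0) z) ≤ inner ℝ (b 1) z := by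
      by_contra! h
      have hV : IsOpen (Metric.ball p r ∩ {w | inner ℝ (b 1) w < γ (inner ℝ (b 0) w)}) :=
        Metric.isOpen_ball.inter (isOpen_lt (by fun_prop) (by fun_prop))
      obtain ⟨w, ⟨hwb, hw⟩, hwΩ⟩ := mem_closure_iff.1 hzf.1 _ hV ⟨hzb, h⟩
      exact lt_asymm hw ((hgraph w hwb).1 hwΩ)
    refine ⟨inner ℝ (b 0) z, ?_, ?_⟩
    · have h1 : |inner ℝ (b 0) (z - p)| ≤ r := by
        refine (abs_real_inner_le_norm _ _).trans ?_
        rw [b.orthonormal.1, one_mul, ← dist_eq_norm]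
        exact (Metric.mem_ball.1 hzb).le
      rw [inner_sub_right, abs_le] at h1
      exact ⟨by linarith, by linarith⟩
    · rw [hc_def]
      simp only [le_antisymm hge hle]
      exact b.eq_fin_two z
  obtain ⟨K, hK⟩ := LocallyLipschitzOn.exists_lipschitzOnWith_of_compact isCompact_Icc
    (hcd.locallyLipschitz.locallyLipschitzOn (s := I))
  refine (measure_mono hsub).trans_lt ((hK.hausdorffMeasure_image_le zero_le_one).trans_lt ?_)
  rw [hausdorffMeasure_real]
  exact ENNReal.mul_lt_top (by simp) isCompact_Icc.measure_lt_top

variable [FiniteDimensional ℝ E]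

/-- A shear translates each vertical line, so Fubini gives invariance of area. -/
theorem measurePreserving_graphHomeomorph (b : OrthonormalBasis (Fin 2) ℝ E) {γ : ℝ → ℝ}
    (hγ : Continuous γ) : MeasurePreserving (graphHomeomorph b hγ) := by
  have h1 : MeasurePreserving (fun p : ℝ × ℝ => (p.1, γ p.1 + p.2)) (volume.prod volume)
      (volume.prod volume) :=
    (MeasurePreserving.id (volume : Measure ℝ)).skew_product
      (g := fun x s => γ x + s) (by fun_prop)
      (Filter.Eventually.of_forall fun x => (measurePreserving_add_left volume (γ x)).map_eq)
  have h2 := ((volume_preserving_finTwoArrow ℝ).symm).comp h1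
  have h3 := (b.measurePreserving_repr_symm).comp
    ((PiLp.volume_preserving_toLp (Fin 2)).comp h2)
  convert! h3 using 1
  ext p
  rw [graphHomeomorph_apply, Function.comp_apply, ← b.sum_repr (b.repr.symm _)]
  simp [Fin.sum_univ_two]

/-- The divergence theorem for the region above the graph of a function. -/
theorem setIntegral_divergence_above_graph (b : OrthonormalBasis (Fin 2) ℝ E) {γ : ℝ → ℝ}
    (hγ : ContDiff ℝ 1 γ) {F : E → E} (hF : ContDiff ℝ 1 F) (hc : HasCompactSupport F) :
    ∫ z in {z | γ (inner ℝ (b 0) z) < inner ℝ (b 1) z}, divergence F z =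
      ∫ t, inner ℝ (deriv γ t • b 0 - b 1) (F (t • b 0 + γ t • b 1)) := by
  set Φ := graphHomeomorph b hγ.continuous with hΦ
  have hΦc : Continuous Φ := Φ.continuous
  have hdγ : Continuous (deriv γ) := hγ.continuous_deriv le_rfl
  have hdF := hF.continuous_fderiv one_ne_zero
  have hcF : HasCompactSupport (fun p => F (Φ p)) := hc.comp_homeomorph Φ
  have hcdF : HasCompactSupport (fun p => fderiv ℝ F (Φ p)) := (hc.fderiv ℝ).comp_homeomorph Φ
  -- In the sheared coordinates the divergence splits as `A' + B'`, where `A'` is a total derivative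
  -- in the first variable and `B'` one in the second. Only `B'` sees the edge `s = 0`.
  set A' : ℝ × ℝ → ℝ := fun p =>
    inner ℝ (b 0) (fderiv ℝ F (Φ p) (b 0 + deriv γ p.1 • b 1)) with hA'
  set B' : ℝ × ℝ → ℝ := fun p =>
    inner ℝ (b 1 - deriv γ p.1 • b 0) (fderiv ℝ F (Φ p) (b 1)) with hB'
  have hA'c : Continuous A' := by fun_prop
  have hB'c : Continuous B' := by fun_prop
  have hA's : HasCompactSupport A' := hcdF.mono fun p hp => by
    contrapose! hp
    simp only [Function.mem_support, not_not] at hp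
    simp [hA', hp]
  have hB's : HasCompactSupport B' := hcdF.mono fun p hp => by
    contrapose! hp
    simp only [Function.mem_support, not_not] at hp
    simp [hB', hp]
  have hA'i : Integrable A' (volume.prod volume) := hA'c.integrable_of_hasCompactSupport hA's
  have hB'i : Integrable B' (volume.prod volume) := hB'c.integrable_of_hasCompactSupport hB's
  have hpre : Φ ⁻¹' {z | γ (inner ℝ (b 0) z) < inner ℝ (b 1) z} = Set.univ ×ˢ Set.Ioi 0 := by
    ext p
    have h01 : inner ℝ (b 0) (b 1) = 0 := b.orthonormal.2 (by decide)
    have h10 : inner ℝ (b 1) (b 0) = 0 := b.orthonormal.2 (by decide)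
    simp [hΦ, graphHomeomorph_apply, inner_add_right, inner_smul_right, h01, h10]
  have hcx (t : ℝ) : Topology.IsClosedEmbedding (fun x : ℝ => (x, t)) :=
    Function.LeftInverse.isClosedEmbedding (f := Prod.fst) (fun _ => rfl) continuous_fst
      (by fun_prop)
  have hcs (t : ℝ) : Topology.IsClosedEmbedding (fun s : ℝ => (t, s)) :=
    Function.LeftInverse.isClosedEmbedding (f := Prod.snd) (fun _ => rfl) continuous_snd
      (by fun_prop)
  have hF0 : Filter.Tendsto (fun p => F (Φ p)) (Filter.cocompact (ℝ × ℝ)) (nhds 0) :=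
    hcF.is_zero_at_infty
  have hdiff : Differentiable ℝ F := hF.differentiable one_ne_zero
  rw [← (measurePreserving_graphHomeomorph b hγ.continuous).setIntegral_preimage_emb
    Φ.measurableEmbedding, hpre]
  have hsum (p : ℝ × ℝ) : divergence F (Φ p) = A' p + B' p := by
    rw [divergence_eq_sum_inner b, Fin.sum_univ_two]
    simp only [hA', hB', map_add, map_smul, inner_add_right, inner_sub_left, inner_smul_right,
      inner_smul_left]
    simp
  have hA0 (s : ℝ) : ∫ x, A' (x, s) = 0 := by
    have hder (x : ℝ) : HasDerivAt (fun x => inner ℝ (b 0) (F (Φ (x, s)))) (A' (x, s)) x := by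
      have h1 : HasDerivAt (fun x => Φ (x, s)) (b 0 + deriv γ x • b 1) x := by
        have h2 := (hasDerivAt_id' x).smul_const (b 0)
        have h3 := ((hγ.differentiable one_ne_zero x).hasDerivAt.add_const s).smul_const (b 1)
        exact (h2.fun_add h3).congr_deriv (by rw [one_smul])
      exact (innerSL ℝ (b 0)).hasFDerivAt.comp_hasDerivAt x
        ((hdiff (Φ (x, s))).hasFDerivAt.comp_hasDerivAt x h1)
    have hlim : Filter.Tendsto (fun x => inner ℝ (b 0) (F (Φ (x, s)))) (Filter.cocompact ℝ)
        (nhds 0) := by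
      simpa using Filter.Tendsto.inner (𝕜 := ℝ) (tendsto_const_nhds (x := b 0))
        (hF0.comp (hcx s).tendsto_cocompact)
    simpa using integral_of_hasDerivAt_of_tendsto hder
      ((hA'c.comp (hcx s).continuous).integrable_of_hasCompactSupport
        (hA's.comp_isClosedEmbedding (hcx s)))
      (hlim.mono_left atBot_le_cocompact) (hlim.mono_left atTop_le_cocompact)
  have hB0 (x : ℝ) : ∫ s in Set.Ioi 0, B' (x, s) =
      inner ℝ (deriv γ x • b 0 - b 1) (F (x • b 0 + γ x • b 1)) := by
    have hder (s : ℝ) : HasDerivAt (fun s => inner ℝ (b 1 - deriv γ x • b 0) (F (Φ (x, s))))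
        (B' (x, s)) s := by
      have h1 : HasDerivAt (fun s => Φ (x, s)) (b 1) s := by
        have h3 := (((hasDerivAt_id' s).const_add (γ x)).smul_const (b 1)).const_add (x • b 0)
        exact h3.congr_deriv (one_smul ℝ _)
      exact (innerSL ℝ (b 1 - deriv γ x • b 0)).hasFDerivAt.comp_hasDerivAt s
        ((hdiff (Φ (x, s))).hasFDerivAt.comp_hasDerivAt s h1)
    have hlim : Filter.Tendsto (fun s => inner ℝ (b 1 - deriv γ x • b 0) (F (Φ (x, s))))
        (Filter.cocompact ℝ) (nhds 0) := by
      simpa using Filter.Tendsto.inner (𝕜 := ℝ)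
        (tendsto_const_nhds (x := b 1 - deriv γ x • b 0)) (hF0.comp (hcs x).tendsto_cocompact)
    rw [integral_Ioi_of_hasDerivAt_of_tendsto (hder 0).continuousAt.continuousWithinAt
      (fun s _ => hder s)
      ((hB'c.comp (hcs x).continuous).integrable_of_hasCompactSupport
        (hB's.comp_isClosedEmbedding (hcs x))).integrableOn
      (hlim.mono_left atTop_le_cocompact), zero_sub, ← inner_neg_left, neg_sub, hΦ,
      graphHomeomorph_apply]
    simp
  change ∫ p in Set.univ ×ˢ Set.Ioi 0, divergence F (Φ p) ∂(volume.prod volume) = _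
  simp_rw [hsum]
  rw [integral_add hA'i.integrableOn hB'i.integrableOn, setIntegral_prod _ hB'i.integrableOn,
    ← Measure.prod_restrict, integral_prod_symm]
  · simp [hA0, hB0]
  · rw [Measure.prod_restrict]
    exact hA'i.integrableOn

/-- The flux of a vector field out of a set whose boundary is a graph where the vector field does
not vanish is at most the integral of its norm over the boundary. -/
theorem ofReal_setIntegral_divergence_le_of_graph (b : OrthonormalBasis (Fin 2) ℝ E) {γ : ℝ → ℝ}
    (hγ : ContDiff ℝ 1 γ) {F : E → E} (hF : ContDiff ℝ 1 F) (hc : HasCompactSupport F)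
    {Ω U : Set E} (hΩ : IsOpen Ω) (hU : IsOpen U) (hFU : tsupport F ⊆ U)
    (hgraph : ∀ z ∈ U, z ∈ Ω ↔ γ (inner ℝ (b 0) z) < inner ℝ (b 1) z) :
    ENNReal.ofReal (∫ z in Ω, divergence F z) ≤ ∫⁻ z in frontier Ω, ‖F z‖ₑ ∂μH[1] := by
  have hγc := hγ.continuous
  have h01 : inner ℝ (b 0) (b 1) = 0 := b.orthonormal.2 (by decide)
  have h10 : inner ℝ (b 1) (b 0) = 0 := b.orthonormal.2 (by decide)
  set G : Set E := {z | γ (inner ℝ (b 0) z) < inner ℝ (b 1) z} with hG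
  have hGo : IsOpen G := isOpen_lt (by fun_prop) (by fun_prop)
  have hΩG : ∫ z in Ω, divergence F z = ∫ z in G, divergence F z := by
    rw [← integral_indicator hΩ.measurableSet, ← integral_indicator hGo.measurableSet]
    congr 1
    ext z
    by_cases hz : z ∈ tsupport F
    · have := hgraph z (hFU hz)
      by_cases hzG : z ∈ G
      · rw [Set.indicator_of_mem hzG, Set.indicator_of_mem (this.2 hzG)]
      · rw [Set.indicator_of_notMem hzG, Set.indicator_of_notMem (fun h => hzG (this.1 h))]
    · simp [Set.indicator, divergence_eq_zero_of_notMem_tsupport hz]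
  set c : ℝ → E := fun t => t • b 0 + γ t • b 1 with hc_def
  have hcd : ContDiff ℝ 1 c := by fun_prop
  have hder (t : ℝ) : deriv c t = b 0 + deriv γ t • b 1 := by
    have h2 := (hasDerivAt_id' t).smul_const (b 0)
    have h3 := ((hγ.differentiable one_ne_zero t).hasDerivAt).smul_const (b 1)
    exact ((h2.fun_add h3).congr_deriv (by rw [one_smul])).deriv
  have hinner (t : ℝ) : inner ℝ (b 0) (c t) = t ∧ inner ℝ (b 1) (c t) = γ t := by
    simp [hc_def, inner_add_right, inner_smul_right, h01, h10]
  have hinj : Function.Injective c := fun s t hst => by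
    rw [← (hinner s).1, hst, (hinner t).1]
  have hfr (t : ℝ) (ht : c t ∈ U) : c t ∈ frontier Ω := by
    rw [hΩ.frontier_eq]
    refine ⟨?_, fun h => ?_⟩
    -- Points just above the graph lie in `Ω` and converge to `c t`.
    · have hlim : Filter.Tendsto (fun s : ℝ => c t + s • b 1) (nhdsWithin 0 (Set.Ioi 0))
          (nhds (c t)) := by
        have : Continuous fun s : ℝ => c t + s • b 1 := by fun_prop
        simpa using (this.tendsto 0).mono_left nhdsWithin_le_nhds
      refine mem_closure_of_tendsto hlim ?_
      filter_upwards [hlim.eventually (hU.mem_nhds ht), self_mem_nhdsWithin] with s hs hs0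
      rw [hgraph _ hs, inner_add_right (b 0) (c t), inner_add_right (b 1) (c t), (hinner t).1,
        (hinner t).2]
      simpa [inner_smul_right, h01] using hs0
    · have := (hgraph _ ht).1 h
      rw [(hinner t).1, (hinner t).2] at this
      exact lt_irrefl _ this
  rw [hΩG, setIntegral_divergence_above_graph b hγ hF hc]
  calc ENNReal.ofReal (∫ t, inner ℝ (deriv γ t • b 0 - b 1) (F (c t)))
      ≤ ‖∫ t, inner ℝ (deriv γ t • b 0 - b 1) (F (c t))‖ₑ := by
        rw [Real.enorm_eq_ofReal_abs]
        exact ENNReal.ofReal_le_ofReal (le_abs_self _)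
    _ ≤ ∫⁻ t, ‖inner ℝ (deriv γ t • b 0 - b 1) (F (c t))‖ₑ := enorm_integral_le_lintegral_enorm _
    _ ≤ ∫⁻ t, ‖deriv c t‖ₑ * ‖F (c t)‖ₑ := by
        refine lintegral_mono fun t => ?_
        rw [hder, ← ofReal_norm, ← ofReal_norm, ← ofReal_norm,
          ← ENNReal.ofReal_mul (norm_nonneg _), norm_graph_tangent]
        exact ENNReal.ofReal_le_ofReal (norm_inner_le_norm _ _)
    _ ≤ ∫⁻ z in Set.range c, ‖F z‖ₑ ∂μH[1] :=
        lintegral_comp_mul_enorm_deriv_le hcd hinj hF.continuous.measurable.enorm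
    _ ≤ ∫⁻ z in frontier Ω, ‖F z‖ₑ ∂μH[1] := by
        rw [← lintegral_indicator
          (hcd.continuous.measurableEmbedding hinj).measurableSet_range,
          ← lintegral_indicator isClosed_frontier.measurableSet]
        refine lintegral_mono fun z => ?_
        by_cases hz : z ∈ Set.range c
        · obtain ⟨t, rfl⟩ := hz
          -- The graph may leave `frontier Ω` outside `U`, but there `F` vanishes.
          by_cases ht : c t ∈ tsupport F
          · rw [Set.indicator_of_mem (Set.mem_range_self t),
              Set.indicator_of_mem (hfr t (hFU ht))]
          · simp [Set.indicator, image_eq_zero_of_notMem_tsupport ht]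
        · simp [Set.indicator_of_notMem hz]

end Graph

/-! ### Finite perimeter and the global flux bound. -/

section Perimeter

variable {Ω : Set (EuclideanSpace ℝ (Fin 2))}

/-- The description of a smooth boundary in terms of orthonormal bases. -/
theorem HasSmoothBoundary.exists_orthonormalBasis (h : HasSmoothBoundary Ω)
    {p : EuclideanSpace ℝ (Fin 2)} (hp : p ∈ frontier Ω) :
    ∃ r > 0, ∃ (b : OrthonormalBasis (Fin 2) ℝ (EuclideanSpace ℝ (Fin 2))) (γ : ℝ → ℝ),
      ContDiff ℝ 1 γ ∧
        ∀ z ∈ Metric.ball p r, z ∈ Ω ↔ γ (inner ℝ (b 0) z) < inner ℝ (b 1) z := by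
  obtain ⟨r, hr, e, γ, hγ, hg⟩ := h p hp
  refine ⟨r, hr, (EuclideanSpace.basisFun (Fin 2) ℝ).map e.symm, γ, hγ.of_le (by norm_cast),
    fun z hz => ?_⟩
  have hb (i : Fin 2) :
      inner ℝ ((EuclideanSpace.basisFun (Fin 2) ℝ).map e.symm i) z = e z i := by
    rw [OrthonormalBasis.map_apply, ← e.inner_map_map, e.apply_symm_apply]
    simp [EuclideanSpace.inner_single_left]
  rw [hb, hb]
  exact hg z hz

theorem HasSmoothBoundary.hausdorffMeasure_frontier_lt_top (h : HasSmoothBoundary Ω)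
    (hopen : IsOpen Ω) (hbdd : Bornology.IsBounded Ω) : μH[1] (frontier Ω) < ⊤ := by
  have hcpt : IsCompact (frontier Ω) :=
    hbdd.isCompact_closure.of_isClosed_subset isClosed_frontier frontier_subset_closure
  refine hcpt.measure_lt_top_of_nhdsWithin fun p hp => ?_
  obtain ⟨r, hr, b, γ, hγ, hg⟩ := h.exists_orthonormalBasis hp
  exact ⟨frontier Ω ∩ Metric.ball p r,
    Filter.inter_mem self_mem_nhdsWithin (mem_nhdsWithin_of_mem_nhds (Metric.ball_mem_nhds p hr)),
    hausdorffMeasure_frontier_inter_ball_lt_top b hγ hopen hg⟩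

/-- The flux of a bounded vector field out of a bounded open set with smooth boundary is at most
the bound times the length of the boundary. -/
theorem HasSmoothBoundary.ofReal_setIntegral_divergence_le (h : HasSmoothBoundary Ω)
    (hopen : IsOpen Ω) (hbdd : Bornology.IsBounded Ω)
    {F : EuclideanSpace ℝ (Fin 2) → EuclideanSpace ℝ (Fin 2)} (hF : ContDiff ℝ 1 F) {C : ℝ}
    (hC : ∀ x, ‖F x‖ ≤ C) :
    ENNReal.ofReal (∫ z in Ω, divergence F z) ≤ ENNReal.ofReal C * μH[1] (frontier Ω) := by
  have hcpt : IsCompact (frontier Ω) :=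
    hbdd.isCompact_closure.of_isClosed_subset isClosed_frontier frontier_subset_closure
  choose! r hr b γ hγ hg using fun p (hp : p ∈ frontier Ω) => h.exists_orthonormalBasis hp
  obtain ⟨t, htf, ht⟩ := hcpt.elim_nhds_subcover (fun p => Metric.ball p (r p))
    fun p hp => Metric.ball_mem_nhds p (hr p hp)
  -- The index `none` stands for the interior piece `Ω`, the others for balls in which the boundary
  -- is a graph.
  let U : Option t → Set (EuclideanSpace ℝ (Fin 2)) := fun i =>
    i.elim Ω fun p => Metric.ball p (r p)
  have hUo (i : Option t) : IsOpen (U i) := by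
    cases i with
    | none => exact hopen
    | some p => exact Metric.isOpen_ball
  have hUb (i : Option t) : Bornology.IsBounded (U i) := by
    cases i with
    | none => exact hbdd
    | some p => exact Metric.isBounded_ball
  have hcov : closure Ω ⊆ ⋃ i, U i := by
    rw [closure_eq_self_union_frontier]
    rintro z (hz | hz)
    · exact Set.mem_iUnion.2 ⟨none, hz⟩
    · obtain ⟨p, hp, hzp⟩ := Set.mem_iUnion₂.1 (ht hz)
      exact Set.mem_iUnion.2 ⟨some ⟨p, hp⟩, hzp⟩
  -- The weights must sum to 1 on the closure: on `Ω` to recover `F`, and on the frontier so that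
  -- the norms of the pieces add up to exactly ‖F‖.
  obtain ⟨f, hf⟩ := SmoothPartitionOfUnity.exists_isSubordinate
    (modelWithCornersSelf ℝ (EuclideanSpace ℝ (Fin 2))) isClosed_closure U hUo hcov
  have hfd (i : Option t) : ContDiff ℝ 1 (f i) :=
    (f i).contMDiff.contDiff.of_le (by norm_cast)
  set G : Option t → EuclideanSpace ℝ (Fin 2) → EuclideanSpace ℝ (Fin 2) :=
    fun i z => f i z • F z with hG
  have hGd (i : Option t) : ContDiff ℝ 1 (G i) := (hfd i).smul hF
  have hGU (i : Option t) : tsupport (G i) ⊆ U i :=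
    (tsupport_smul_subset_left _ _).trans (hf i)
  have hGc (i : Option t) : HasCompactSupport (G i) :=
    Metric.isCompact_of_isClosed_isBounded (isClosed_tsupport _) ((hUb i).subset (hGU i))
  have hsum {z : EuclideanSpace ℝ (Fin 2)} (hz : z ∈ closure Ω) : ∑ i, f i z = 1 := by
    rw [← finsum_eq_sum_of_fintype]
    exact f.sum_eq_one hz
  have hdiv : ∫ z in Ω, divergence F z = ∑ i, ∫ z in Ω, divergence (G i) z := by
    rw [← integral_finsetSum _ fun i _ => (integrable_divergence (hGd i) (hGc i)).integrableOn]
    refine setIntegral_congr_fun hopen.measurableSet fun z hz => ?_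
    have hev : F =ᶠ[nhds z] fun y => ∑ i, G i y := by
      filter_upwards [hopen.mem_nhds hz] with y hy
      rw [hG, ← Finset.sum_smul, hsum (subset_closure hy), one_smul]
    rw [← divergence_sum Finset.univ fun i _ => (hGd i).differentiable one_ne_zero z, divergence,
      hev.fderiv_eq, divergence]
  have hle (i : Option t) : ENNReal.ofReal (∫ z in Ω, divergence (G i) z) ≤
      ∫⁻ z in frontier Ω, ‖G i z‖ₑ ∂μH[1] := by
    cases i with
    | none =>
      -- The interior piece has compact support in `Ω`, hence no flux.
      rw [setIntegral_eq_integral_of_forall_compl_eq_zero fun z (hz : z ∉ Ω) =>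
        divergence_eq_zero_of_notMem_tsupport fun hz' => hz (hGU none hz'),
        integral_divergence_eq_zero (hGd none) (hGc none)]
      simp
    | some p =>
      have hp := htf p p.2
      exact ofReal_setIntegral_divergence_le_of_graph (b p) (hγ p hp) (hGd _) (hGc _) hopen
        Metric.isOpen_ball (hGU (some p)) (hg p hp)
  calc ENNReal.ofReal (∫ z in Ω, divergence F z)
      ≤ ∑ i, ENNReal.ofReal (∫ z in Ω, divergence (G i) z) := by
        rw [hdiv]
        exact Finset.le_sum_of_subadditive _ ENNReal.ofReal_zero.le
          (fun x y => ENNReal.ofReal_add_le) _ _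
    _ ≤ ∑ i, ∫⁻ z in frontier Ω, ‖G i z‖ₑ ∂μH[1] := Finset.sum_le_sum fun i _ => hle i
    _ = ∫⁻ z in frontier Ω, ∑ i, ‖G i z‖ₑ ∂μH[1] :=
        (lintegral_finsetSum _ fun i _ => (hGd i).continuous.measurable.enorm).symm
    _ ≤ ∫⁻ _ in frontier Ω, ENNReal.ofReal C ∂μH[1] := by
        refine setLIntegral_mono measurable_const fun z hz => ?_
        have h1 (i : Option t) : ‖G i z‖ₑ = ENNReal.ofReal (f i z * ‖F z‖) := by
          rw [← ofReal_norm, hG, norm_smul, Real.norm_of_nonneg (f.nonneg i z)]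
        simp_rw [h1]
        rw [← ENNReal.ofReal_sum_of_nonneg fun i _ =>
          mul_nonneg (f.nonneg i z) (norm_nonneg _), ← Finset.sum_mul,
          hsum (frontier_subset_closure hz), one_mul]
        exact ENNReal.ofReal_le_ofReal (hC z)
    _ = ENNReal.ofReal C * μH[1] (frontier Ω) := setLIntegral_const _ _

/-- Real-valued form of `HasSmoothBoundary.ofReal_setIntegral_divergence_le`. -/
theorem HasSmoothBoundary.setIntegral_divergence_le (h : HasSmoothBoundary Ω)
    (hopen : IsOpen Ω) (hbdd : Bornology.IsBounded Ω)
    {F : EuclideanSpace ℝ (Fin 2) → EuclideanSpace ℝ (Fin 2)} (hF : ContDiff ℝ 1 F) {C : ℝ}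
    (hC : ∀ x, ‖F x‖ ≤ C) :
    ∫ z in Ω, divergence F z ≤ C * μH[1].real (frontier Ω) := by
  have hC0 : 0 ≤ C := (norm_nonneg _).trans (hC 0)
  have hfin := (h.hausdorffMeasure_frontier_lt_top hopen hbdd).ne
  have h1 := h.ofReal_setIntegral_divergence_le hopen hbdd hF hC
  rw [ENNReal.ofReal_le_iff_le_toReal (ENNReal.mul_ne_top ENNReal.ofReal_ne_top hfin),
    ENNReal.toReal_mul, ENNReal.toReal_ofReal hC0] at h1
  exact h1

end Perimeter

/-! ### Regularized reflections and their divergences. -/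

section Kernel

variable {E : Type*} [NormedAddCommGroup E] [InnerProductSpace ℝ E]

/-- A regularization of the reflection of `v` in the line orthogonal to `z`. -/
noncomputable def chordReflection (ε : ℝ) (v z : E) : E :=
  v - (2 * inner ℝ z v / (‖z‖ ^ 2 + ε)) • z

/-- The divergence of the regularized reflections, as a vector. -/
noncomputable def chordField (ε : ℝ) (z : E) : E :=
  (2 / (‖z‖ ^ 2 + ε) + 4 * ε / (‖z‖ ^ 2 + ε) ^ 2) • z

/-- An approximation of `4π` times the Dirac mass, as a function of the norm. -/
noncomputable def chordKernel (ε : ℝ) (r : ℝ) : ℝ :=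
  16 * ε ^ 2 / (r ^ 2 + ε) ^ 3 - 4 * ε / (r ^ 2 + ε) ^ 2

/-- For ε = 0 and z ≠ 0 this is an isometry. In general the squared norm drops by 4⟪z, v⟫²ε/(‖z‖² +
ε)². -/
theorem norm_chordReflection_le {ε : ℝ} (hε : 0 < ε) (v z : E) :
    ‖chordReflection ε v z‖ ≤ ‖v‖ := by
  have hρ : 0 < ‖z‖ ^ 2 + ε := by positivity
  rw [← sq_le_sq₀ (norm_nonneg _) (norm_nonneg _), chordReflection, norm_sub_sq_real,
    inner_smul_right, norm_smul, mul_pow, Real.norm_eq_abs, sq_abs, real_inner_comm z v]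
  set a := inner ℝ z v
  have : 2 * (2 * a / (‖z‖ ^ 2 + ε) * a) - (2 * a / (‖z‖ ^ 2 + ε)) ^ 2 * ‖z‖ ^ 2 =
      4 * a ^ 2 * ε / (‖z‖ ^ 2 + ε) ^ 2 := by
    field_simp; ring
  have h2 : 0 ≤ 4 * a ^ 2 * ε / (‖z‖ ^ 2 + ε) ^ 2 := by positivity
  linarith

theorem contDiff_chordReflection {ε : ℝ} (hε : 0 < ε) (v : E) {n : ℕ∞ω} :
    ContDiff ℝ n (chordReflection ε v) := by
  have hρ (z : E) : ‖z‖ ^ 2 + ε ≠ 0 := by positivity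
  have h1 : ContDiff ℝ n fun z : E => ‖z‖ ^ 2 := contDiff_norm_sq ℝ
  have h2 : ContDiff ℝ n fun z : E => inner ℝ z v := contDiff_id.inner ℝ contDiff_const
  exact contDiff_const.sub
    (((contDiff_const.mul h2).div (h1.add contDiff_const) hρ).smul contDiff_id)

theorem contDiff_chordField {ε : ℝ} (hε : 0 < ε) {n : ℕ∞ω} :
    ContDiff ℝ n (chordField ε : E → E) := by
  have hρ (z : E) : ‖z‖ ^ 2 + ε ≠ 0 := by positivity
  have h1 : ContDiff ℝ n fun z : E => ‖z‖ ^ 2 := contDiff_norm_sq ℝ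
  have h2 := h1.add (contDiff_const (c := ε))
  exact ((contDiff_const.div h2 hρ).add (contDiff_const.div (h2.pow 2)
    fun z => pow_ne_zero 2 (hρ z))).smul contDiff_id

theorem hasFDerivAt_norm_sq_add (ε : ℝ) (z : E) :
    HasFDerivAt (fun z : E => ‖z‖ ^ 2 + ε) (2 • innerSL ℝ z) z :=
  ((hasStrictFDerivAt_norm_sq z).hasFDerivAt).add_const ε

theorem divergence_smul_id [FiniteDimensional ℝ E] {f : E → ℝ} {f' : E →L[ℝ] ℝ} {z : E}
    (hf : HasFDerivAt f f' z) :
    divergence (fun z => f z • z) z = f z * Module.finrank ℝ E + f' z := by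
  have := (hf.smul (hasFDerivAt_id z)).fderiv
  rw [divergence, show (fun z => f z • z) = f • id from rfl, this]
  simp

theorem divergence_chordReflection [FiniteDimensional ℝ E] (hE : Module.finrank ℝ E = 2)
    {ε : ℝ} (hε : 0 < ε) (v z : E) :
    divergence (chordReflection ε v) z = -inner ℝ (chordField ε z) v := by
  have hρ : ‖z‖ ^ 2 + ε ≠ 0 := by positivity
  have hn : HasFDerivAt (fun z : E => 2 * inner ℝ z v) ((2 : ℝ) • innerSL ℝ v) z := by
    have := ((innerSL ℝ v).hasFDerivAt (x := z)).const_mul 2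
    simpa [real_inner_comm] using this
  have hd := hasFDerivAt_norm_sq_add ε z
  have h1 := divergence_smul_id (hn.mul ((hasDerivAt_inv hρ).comp_hasFDerivAt z hd))
  have h2 : divergence (chordReflection ε v) z =
      -divergence (fun z : E => (2 * inner ℝ z v * (‖z‖ ^ 2 + ε)⁻¹) • z) z := by
    have h3 : chordReflection ε v = fun z => v - (2 * inner ℝ z v / (‖z‖ ^ 2 + ε)) • z := rfl
    simp only [divergence]
    rw [h3, fderiv_const_sub, ContinuousLinearMap.toLinearMap_neg, map_neg]
    simp only [div_eq_mul_inv]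
  rw [h2]
  refine congrArg Neg.neg (h1.trans ?_)
  simp [hE, chordField, inner_smul_left, real_inner_comm]
  field_simp
  ring

/-- For fixed z ≠ 0 this tends to 0 with ε, as 2z/‖z‖² is divergence-free off the origin in the
plane; the mass concentrates at 0. -/
theorem divergence_chordField [FiniteDimensional ℝ E] (hE : Module.finrank ℝ E = 2)
    {ε : ℝ} (hε : 0 < ε) (z : E) :
    divergence (chordField ε) z = chordKernel ε ‖z‖ := by
  have hρ : ‖z‖ ^ 2 + ε ≠ 0 := by positivity
  have hd := hasFDerivAt_norm_sq_add ε z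
  have h3 : HasDerivAt (fun q : ℝ => 2 / q + 4 * ε / q ^ 2)
      (2 * -((‖z‖ ^ 2 + ε) ^ 2)⁻¹ + 4 * ε * (-(2 * (‖z‖ ^ 2 + ε)) / ((‖z‖ ^ 2 + ε) ^ 2) ^ 2))
      (‖z‖ ^ 2 + ε) := by
    have h4 := (hasDerivAt_pow 2 (‖z‖ ^ 2 + ε)).fun_inv (pow_ne_zero 2 hρ)
    simpa [div_eq_mul_inv] using ((hasDerivAt_inv hρ).const_mul 2).fun_add (h4.const_mul (4 * ε))
  have h1 := divergence_smul_id (h3.comp_hasFDerivAt z hd)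
  refine h1.trans ?_
  simp [hE, chordKernel]
  field_simp
  ring

end Kernel

/-! ### Convolution with the indicator of a bounded set. -/

section Smoothing

variable {E : Type*} [NormedAddCommGroup E] [InnerProductSpace ℝ E]

theorem divergence_comp_const_sub {g : E → E} {x y : E}
    (hg : DifferentiableAt ℝ g (x - y)) :
    divergence (fun y => g (x - y)) y = -divergence g (x - y) := by
  have h := hg.hasFDerivAt.comp y ((hasFDerivAt_id y).const_sub x)
  rw [divergence, divergence, show (fun y => g (x - y)) = g ∘ HSub.hSub x from rfl, h.fderiv]
  simp

variable [FiniteDimensional ℝ E] {V : Type*} [NormedAddCommGroup V]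

/-- Supplies the constant dominating function for continuity and differentiation under the integral.
-/
theorem exists_bound_comp_sub {g : E → V} (hg : Continuous g) {s : Set E}
    (hs : Bornology.IsBounded s) (x₀ : E) :
    ∃ M, ∀ y ∈ s, ∀ x ∈ Metric.ball x₀ 1, ‖g (x - y)‖ ≤ M := by
  obtain ⟨R, hR⟩ := hs.exists_norm_le
  obtain ⟨M, hM⟩ := (isCompact_closedBall (0 : E) (‖x₀‖ + 1 + R)).exists_bound_of_continuousOn
    hg.continuousOn
  refine ⟨M, fun y hy x hx => hM _ ?_⟩
  rw [mem_closedBall_zero_iff]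
  have h1 : ‖x - x₀‖ < 1 := by rwa [← dist_eq_norm]
  calc ‖x - y‖ = ‖(x - x₀) + x₀ - y‖ := by rw [sub_add_cancel]
    _ ≤ ‖x - x₀‖ + ‖x₀‖ + ‖y‖ := (norm_sub_le _ _).trans (by gcongr; exact norm_add_le _ _)
    _ ≤ ‖x₀‖ + 1 + R := by linarith [hR y hy]

variable [MeasurableSpace E] [BorelSpace E]

theorem integrableOn_comp_sub {g : E → V} (hg : Continuous g) {s : Set E}
    (hs : Bornology.IsBounded s) (x : E) : IntegrableOn (fun y => g (x - y)) s :=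
  ((by fun_prop : Continuous fun y => g (x - y)).continuousOn.integrableOn_compact
    hs.isCompact_closure).mono_set subset_closure

variable [NormedSpace ℝ V]

theorem continuous_setIntegral_comp_sub {g : E → V} (hg : Continuous g) {s : Set E}
    (hs : Bornology.IsBounded s) (hsm : MeasurableSet s) :
    Continuous fun x => ∫ y in s, g (x - y) := by
  refine continuous_iff_continuousAt.2 fun x₀ => ?_
  obtain ⟨M, hM⟩ := exists_bound_comp_sub hg hs x₀
  refine continuousAt_of_dominated (bound := fun _ => M)
    (.of_forall fun x => (integrableOn_comp_sub hg hs x).aestronglyMeasurable) ?_ ?_ ?_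
  · filter_upwards [Metric.ball_mem_nhds x₀ one_pos] with x hx
    exact (ae_restrict_iff' hsm).2 (.of_forall fun y hy => hM y hy x hx)
  · exact integrableOn_const hs.measure_lt_top.ne
  · exact .of_forall fun y => by fun_prop

theorem hasFDerivAt_setIntegral_comp_sub {g : E → V} (hg : ContDiff ℝ 1 g) {s : Set E}
    (hs : Bornology.IsBounded s) (hsm : MeasurableSet s) (x₀ : E) :
    HasFDerivAt (fun x => ∫ y in s, g (x - y)) (∫ y in s, fderiv ℝ g (x₀ - y)) x₀ := by
  have hd := hg.continuous_fderiv one_ne_zero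
  obtain ⟨M, hM⟩ := exists_bound_comp_sub hd hs x₀
  refine hasFDerivAt_integral_of_dominated_of_fderiv_le (bound := fun _ => M)
    (F' := fun x y => fderiv ℝ g (x - y))
    (Metric.ball_mem_nhds x₀ one_pos)
    (.of_forall fun x => (integrableOn_comp_sub hg.continuous hs x).aestronglyMeasurable)
    (integrableOn_comp_sub hg.continuous hs x₀)
    (integrableOn_comp_sub hd hs x₀).aestronglyMeasurable ?_ ?_ ?_
  · exact (ae_restrict_iff' hsm).2 (.of_forall fun y hy => hM y hy)
  · exact integrableOn_const hs.measure_lt_top.ne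
  · refine .of_forall fun y x _ => ?_
    exact (hg.differentiable one_ne_zero (x - y)).hasFDerivAt.comp x
      ((hasFDerivAt_id x).sub_const y)

theorem contDiff_setIntegral_comp_sub {g : E → V} (hg : ContDiff ℝ 1 g) {s : Set E}
    (hs : Bornology.IsBounded s) (hsm : MeasurableSet s) :
    ContDiff ℝ 1 fun x => ∫ y in s, g (x - y) := by
  have hder := hasFDerivAt_setIntegral_comp_sub hg hs hsm
  rw [contDiff_one_iff_fderiv]
  refine ⟨fun x => (hder x).differentiableAt, ?_⟩
  rw [funext fun x => (hder x).fderiv]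
  exact continuous_setIntegral_comp_sub (hg.continuous_fderiv one_ne_zero) hs hsm

theorem divergence_setIntegral_comp_sub {g : E → E} (hg : ContDiff ℝ 1 g) {s : Set E}
    (hs : Bornology.IsBounded s) (hsm : MeasurableSet s) (x : E) :
    divergence (fun x => ∫ y in s, g (x - y)) x = ∫ y in s, divergence g (x - y) := by
  rw [divergence, (hasFDerivAt_setIntegral_comp_sub hg hs hsm x).fderiv]
  let T : (E →L[ℝ] E) →L[ℝ] ℝ :=
    LinearMap.toContinuousLinearMap (LinearMap.trace ℝ E ∘ₗ ContinuousLinearMap.coeLM ℝ)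
  exact (T.integral_comp_comm
    (integrableOn_comp_sub (hg.continuous_fderiv one_ne_zero) hs x)).symm

end Smoothing

/-! ### The two applications of the flux bound. -/

section KernelInequality

variable {Ω : Set (EuclideanSpace ℝ (Fin 2))}

/-- The smoothed isoperimetric inequality. -/
theorem HasSmoothBoundary.integral_chordKernel_le (h : HasSmoothBoundary Ω)
    (hopen : IsOpen Ω) (hbdd : Bornology.IsBounded Ω) {ε : ℝ} (hε : 0 < ε) :
    ∫ x in Ω, ∫ y in Ω, chordKernel ε ‖x - y‖ ≤ μH[1].real (frontier Ω) ^ 2 := by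
  have hE : Module.finrank ℝ (EuclideanSpace ℝ (Fin 2)) = 2 := by simp
  have hg : ContDiff ℝ 1 (chordField ε : EuclideanSpace ℝ (Fin 2) → _) := contDiff_chordField hε
  set P := μH[1].real (frontier Ω)
  have hP : 0 ≤ P := measureReal_nonneg
  set G : EuclideanSpace ℝ (Fin 2) → EuclideanSpace ℝ (Fin 2) :=
    fun x => ∫ y in Ω, chordField ε (x - y) with hG
  have hGv (x v) : inner ℝ (G x) v ≤ ‖v‖ * P := by
    have h1 : inner ℝ (G x) v = ∫ y in Ω, divergence (fun y => chordReflection ε v (x - y)) y := by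
      rw [hG, real_inner_comm, ← integral_inner (integrableOn_comp_sub hg.continuous hbdd x)]
      refine integral_congr_ae (.of_forall fun y => ?_)
      simp only
      rw [divergence_comp_const_sub
        ((contDiff_chordReflection (n := 1) hε v).differentiable one_ne_zero _),
         divergence_chordReflection hE hε, neg_neg, real_inner_comm]
    rw [h1]
    exact h.setIntegral_divergence_le hopen hbdd
      ((contDiff_chordReflection hε v).comp (contDiff_const.sub contDiff_id))
      fun y => norm_chordReflection_le hε v _
  have hGn (x) : ‖G x‖ ≤ P := by
    -- Testing with v = G(x) turns the bound on pairings into a bound on the norm.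
    have := hGv x (G x)
    rw [real_inner_self_eq_norm_sq, sq] at this
    rcases (norm_nonneg (G x)).eq_or_lt with h0 | h0
    · rw [← h0]; exact hP
    · exact le_of_mul_le_mul_left this h0
  have h2 := h.setIntegral_divergence_le hopen hbdd
    (contDiff_setIntegral_comp_sub hg hbdd hopen.measurableSet) hGn
  simp_rw [divergence_setIntegral_comp_sub hg hbdd hopen.measurableSet,
    divergence_chordField hE hε] at h2
  rwa [sq]

end KernelInequality

/-! ### The kernel as an approximate identity of mass 4π. -/

section Limit

variable {E : Type*} [NormedAddCommGroup E] [InnerProductSpace ℝ E]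

/-- With ε = δ², δ is a length scale; the factor δ⁻² is the Jacobian of planar dilation. -/
theorem chordKernel_sq {δ : ℝ} (hδ : 0 < δ) (r : ℝ) :
    chordKernel (δ ^ 2) (δ * r) = (δ ^ 2)⁻¹ * chordKernel 1 r := by
  have h1 : r ^ 2 + 1 ≠ 0 := by positivity
  have h2 : (δ * r) ^ 2 + δ ^ 2 = δ ^ 2 * (r ^ 2 + 1) := by ring
  rw [chordKernel, chordKernel, h2]
  field_simp

theorem continuous_chordKernel_one : Continuous (chordKernel 1) := by
  unfold chordKernel
  fun_prop (disch := intro x; positivity)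

theorem hasDerivAt_chordKernel_primitive (r : ℝ) :
    HasDerivAt (fun r : ℝ => 2 * (r ^ 2 + 1)⁻¹ - 4 * ((r ^ 2 + 1) ^ 2)⁻¹)
      (r * chordKernel 1 r) r := by
  have h1 : r ^ 2 + 1 ≠ 0 := by positivity
  have hd : HasDerivAt (fun r : ℝ => r ^ 2 + 1) (2 * r) r := by
    simpa using (hasDerivAt_pow 2 r).add_const 1
  have := ((hd.fun_inv h1).const_mul 2).fun_sub
    (((hd.fun_pow 2).fun_inv (pow_ne_zero 2 h1)).const_mul 4)
  refine this.congr_deriv ?_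
  simp [chordKernel]
  field_simp
  ring

theorem tendsto_chordKernel_primitive :
    Filter.Tendsto (fun r : ℝ => 2 * (r ^ 2 + 1)⁻¹ - 4 * ((r ^ 2 + 1) ^ 2)⁻¹)
      Filter.atTop (nhds 0) := by
  have h1 : Filter.Tendsto (fun r : ℝ => r ^ 2 + 1) Filter.atTop Filter.atTop :=
    Filter.tendsto_atTop_add_const_right _ _ (Filter.tendsto_pow_atTop two_ne_zero)
  have h2 := h1.inv_tendsto_atTop
  have h3 := ((Filter.tendsto_pow_atTop two_ne_zero).comp h1).inv_tendsto_atTop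
  simpa using (h2.const_mul 2).sub (h3.const_mul 4)

theorem abs_chordKernel_one_le (r : ℝ) : |chordKernel 1 r| ≤ 20 * ((1 + r ^ 2) ^ 2)⁻¹ := by
  have h1 : 1 ≤ 1 + r ^ 2 := by nlinarith [sq_nonneg r]
  have h : chordKernel 1 r = (16 * (1 + r ^ 2)⁻¹ - 4) * ((1 + r ^ 2) ^ 2)⁻¹ := by
    rw [chordKernel, add_comm (r ^ 2)]
    field_simp
  rw [h, abs_mul, abs_of_nonneg (by positivity : 0 ≤ ((1 + r ^ 2) ^ 2)⁻¹)]
  have h2 := inv_le_one_of_one_le₀ h1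
  have h3 : 0 ≤ (1 + r ^ 2)⁻¹ := by positivity
  gcongr
  rw [abs_le]
  constructor <;> linarith

variable [MeasurableSpace E] [BorelSpace E] [FiniteDimensional ℝ E]

theorem integrable_chordKernel_one (hE : Module.finrank ℝ E = 2) :
    Integrable fun z : E => chordKernel 1 ‖z‖ := by
  have h1 : Integrable fun z : E => (1 + ‖z‖ ^ 2) ^ (-(4 : ℝ) / 2) :=
    integrable_rpow_neg_one_add_norm_sq (by rw [hE]; norm_num)
  refine (h1.const_mul 20).mono'
    (continuous_chordKernel_one.comp continuous_norm).aestronglyMeasurable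
    (.of_forall fun z => ?_)
  refine (abs_chordKernel_one_le _).trans (le_of_eq ?_)
  rw [show (-(4 : ℝ) / 2) = -2 by norm_num, Real.rpow_neg (by positivity)]
  norm_num

theorem integral_chordKernel_one :
    ∫ z : EuclideanSpace ℝ (Fin 2), chordKernel 1 ‖z‖ = 4 * Real.pi := by
  have hE : Module.finrank ℝ (EuclideanSpace ℝ (Fin 2)) = 2 := by simp
  have hint := (integrable_fun_norm_addHaar (volume : Measure (EuclideanSpace ℝ (Fin 2)))).1
    (integrable_chordKernel_one hE)
  rw [integral_fun_norm_addHaar]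
  rw [hE] at hint ⊢
  simp only [Nat.add_one_sub_one, pow_one, smul_eq_mul] at hint ⊢
  -- In polar coordinates the primitive rises from -2 at r = 0 to 0 at infinity; the angular factor
  -- 2π then gives 4π.
  rw [integral_Ioi_of_hasDerivAt_of_tendsto
    (hasDerivAt_chordKernel_primitive 0).continuousAt.continuousWithinAt
    (fun r _ => hasDerivAt_chordKernel_primitive r) hint tendsto_chordKernel_primitive,
    Measure.real, EuclideanSpace.volume_ball_fin_two]
  simp [Real.pi_nonneg]
  ring

theorem setIntegral_chordKernel_sq (hE : Module.finrank ℝ E = 2) {Ω : Set E}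
    (hΩ : MeasurableSet Ω) {δ : ℝ} (hδ : 0 < δ) (x : E) :
    ∫ y in Ω, chordKernel (δ ^ 2) ‖x - y‖ =
      ∫ w, Ω.indicator (fun _ => chordKernel 1 ‖w‖) (x - δ • w) := by
  rw [← integral_indicator hΩ]
  set f : E → ℝ := Ω.indicator fun y => chordKernel (δ ^ 2) ‖x - y‖ with hf
  have h1 : ∫ w, f (x - δ • w) = (δ ^ 2)⁻¹ * ∫ y, f y := by
    rw [Measure.integral_comp_smul volume (fun u => f (x - u)) δ, integral_sub_left_eq_self, hE,
      abs_of_nonneg (by positivity), smul_eq_mul]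
  have h2 (w : E) : Ω.indicator (fun _ => chordKernel 1 ‖w‖) (x - δ • w) =
      δ ^ 2 * f (x - δ • w) := by
    simp only [hf, Set.indicator]
    split_ifs
    · rw [sub_sub_cancel, norm_smul, Real.norm_of_nonneg hδ.le, chordKernel_sq hδ]
      field_simp
    · simp
  simp_rw [h2]
  rw [integral_const_mul, h1]
  field_simp

theorem tendsto_integral_chordKernel (hE : Module.finrank ℝ E = 2) {Ω : Set E} (hΩ : IsOpen Ω)
    (hfin : volume Ω ≠ ⊤) :
    Filter.Tendsto (fun δ : ℝ => ∫ x in Ω, ∫ y in Ω, chordKernel (δ ^ 2) ‖x - y‖)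
      (nhdsWithin 0 (Set.Ioi 0)) (nhds (volume.real Ω * ∫ z : E, chordKernel 1 ‖z‖)) := by
  have hint := integrable_chordKernel_one hE
  have heq : (fun δ : ℝ => ∫ x in Ω, ∫ w, Ω.indicator (fun _ => chordKernel 1 ‖w‖) (x - δ • w))
      =ᶠ[nhdsWithin 0 (Set.Ioi 0)]
      fun δ : ℝ => ∫ x in Ω, ∫ y in Ω, chordKernel (δ ^ 2) ‖x - y‖ := by
    filter_upwards [self_mem_nhdsWithin] with δ hδ
    simp_rw [setIntegral_chordKernel_sq hE hΩ.measurableSet hδ]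
  refine Filter.Tendsto.congr' heq ?_
  have hmeas (δ : ℝ) : Measurable fun p : E × E =>
      Ω.indicator (fun _ => chordKernel 1 ‖p.2‖) (p.1 - δ • p.2) := by
    have hS : MeasurableSet {p : E × E | p.1 - δ • p.2 ∈ Ω} :=
      (hΩ.preimage (by fun_prop : Continuous fun p : E × E => p.1 - δ • p.2)).measurableSet
    exact Measurable.ite hS
      (continuous_chordKernel_one.comp (continuous_norm.comp continuous_snd)).measurable
      measurable_const
  have hbound (δ : ℝ) (x w : E) : ‖Ω.indicator (fun _ => chordKernel 1 ‖w‖) (x - δ • w)‖ ≤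
      ‖chordKernel 1 ‖w‖‖ := by
    simp only [Set.indicator]
    split_ifs <;> simp
  have hlim : volume.real Ω * ∫ z : E, chordKernel 1 ‖z‖ =
      ∫ _ in Ω, ∫ z : E, chordKernel 1 ‖z‖ := by simp
  rw [hlim]
  refine tendsto_integral_filter_of_dominated_convergence
    (fun _ => ∫ z : E, ‖chordKernel 1 ‖z‖‖) (.of_forall fun δ => ?_) (.of_forall fun δ => ?_)
    (integrableOn_const hfin) ?_
  · exact ((hmeas δ).stronglyMeasurable.integral_prod_right (ν := volume)).aestronglyMeasurable
  · exact .of_forall fun x => norm_integral_le_of_norm_le hint.norm (.of_forall (hbound δ x))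
  · refine (ae_restrict_iff' hΩ.measurableSet).2 (.of_forall fun x hx => ?_)
    refine tendsto_integral_filter_of_dominated_convergence
      (fun w => ‖chordKernel 1 ‖w‖‖) (.of_forall fun δ => ?_)
      (.of_forall fun δ => .of_forall (hbound δ x)) hint.norm (.of_forall fun w => ?_)
    · exact ((hmeas δ).comp measurable_prodMk_left).aestronglyMeasurable
    -- As `Ω` is open, x - δw lies in it for small δ, so the integrand is eventually constant in δ.
    -- The kernel changes sign, hence domination by its absolute value.
    · refine tendsto_const_nhds.congr' ?_
      have hc : Filter.Tendsto (fun δ : ℝ => x - δ • w) (nhdsWithin 0 (Set.Ioi 0)) (nhds x) := by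
        have : Continuous fun δ : ℝ => x - δ • w := by fun_prop
        simpa using (this.tendsto 0).mono_left nhdsWithin_le_nhds
      filter_upwards [hc.eventually (hΩ.mem_nhds hx)] with δ hδ
      exact (Set.indicator_of_mem hδ (fun _ => chordKernel 1 ‖w‖)).symm

end Limit

theorem mainTheorem1 (Ω : Set (EuclideanSpace ℝ (Fin 2)))
    (hopen : IsOpen Ω) (hbdd : Bornology.IsBounded Ω) (hsmooth : HasSmoothBoundary Ω) :
    μH[1] (frontier Ω) < ⊤ ∧
      μH[1].real (frontier Ω) ^ 2 ≥ 4 * Real.pi * volume.real Ω := by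
  refine ⟨hsmooth.hausdorffMeasure_frontier_lt_top hopen hbdd, ?_⟩
  have hlim := tendsto_integral_chordKernel (by simp) hopen hbdd.measure_lt_top.ne
  rw [integral_chordKernel_one, mul_comm] at hlim
  refine le_of_tendsto hlim ?_
  filter_upwards [self_mem_nhdsWithin] with δ (hδ : 0 < δ)
  exact hsmooth.integral_chordKernel_le hopen hbdd (by positivity)
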